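/- Let $m\ge 2$ and let $O\subset\mathbb{R}^m$ be a strictly convex compact set with non-empty interior and smooth ($C^\infty$) boundary, contained in some closed ball of radius smaller than $\sqrt2/4$. For $\mathbf{k}\in\mathbb{Z}^m$ put $O_{\mathbf{k}}=O+\mathbf{k}$, and consider the billiard in the complement of the interiors of the obstacles $O_{\mathbf{k}}$ (the lifting to $\mathbb{R}^m$ of the billiard on the torus $\mathbb{R}^m/\mathbb{Z}^m$ with the obstacle $O$), with unit speed and specular reflection. Say that $O_{\mathbf{k}}$ is between $O_{\mathbf{i}}$ and $O_{\mathbf{j}}$ if $\mathbf{k}\ne\mathbf{i},\mathbf{j}$ and $O_{\mathbf{k}}$ intersects the convex hull of $O_{\mathbf{i}}\cup O_{\mathbf{j}}$. A finite sequence $(\mathbf{k}_n)_{n=0}^s$ in $\mathbb{Z}^m$ is admissible if $\mathbf{k}_0=\mathbf{0}$, and $\mathbf{k}_{n+1}\ne\mathbf{k}_n$ and no obstacle is between $O_{\mathbf{k}_n}$ and $O_{\mathbf{k}_{n+1}}$ for $0\le n<s$, and $O_{\mathbf{k}_{n+1}}$ is not between $O_{\mathbf{k}_n}$ and $O_{\mathbf{k}_{n+2}}$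 for $0\le n\le s-2$. A trajectory piece has type $(\mathbf{k}_n)_{n=0}^s$ if it starts on the boundary of $O_{\mathbf{k}_0}$, reflects (tangencies do not count as reflections) consecutively from $O_{\mathbf{k}_1},\dots,O_{\mathbf{k}_s}$, and ends at its reflection point on $O_{\mathbf{k}_s}$. Let the admissible rotation set $AR\subset\mathbb{R}^m$ be the set of all limits of sequences $\bigl((\mathbf{y}_n-\mathbf{x}_n)/t_n\bigr)_{n\ge1}$ such that for every $n$ there is a trajectory piece of admissible type from $\mathbf{x}_n$ to $\mathbf{y}_n$ of length $t_n$, and $t_n\to\infty$. Then $AR$ contains the closed ball centered at $\mathbf{0}$ with radius $\sqrt{2/(\ln m+5)}$. -/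

import Mathlib

open scoped ContDiff

namespace TorusBilliard

/-- The Euclidean space `ℝ^m`, universal covering of the torus `ℝ^m / ℤ^m`. -/
abbrev Space (m : ℕ) : Type := EuclideanSpace ℝ (Fin m)

/-- The integer vector `k ∈ ℤ^m`, seen in `ℝ^m`. -/
noncomputable def latticeVec {m : ℕ} (k : Fin m → ℤ) : Space m :=
  WithLp.toLp 2 (fun i => (k i : ℝ))

/-- The lifted obstacle `O_k`: the lift `O = O_0` translated by the integer vector `k`. -/
def lifted {m : ℕ} (O : Set (Space m)) (k : Fin m → ℤ) : Set (Space m) :=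
  (fun x => latticeVec k + x) '' O

/-- The boundary of `O` is a smooth hypersurface: near each of its boundary points, `O` is the
sublevel set of a smooth function with non-vanishing differential. -/
def HasSmoothBoundary {m : ℕ} (O : Set (Space m)) : Prop :=
  ∀ p ∈ frontier O, ∃ (U : Set (Space m)) (f : Space m → ℝ),
    IsOpen U ∧ p ∈ U ∧ ContDiffOn ℝ ∞ f U ∧ (∀ x ∈ U, fderiv ℝ f x ≠ 0) ∧
      O ∩ U = {x ∈ U | f x ≤ 0}

/-- `O ⊆ ℝ^m` is (a lift of) an obstacle: a strictly convex body with smooth boundary.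
For closed convex sets, `StrictConvex` says that the boundary contains no line segment. -/
structure IsObstacle {m : ℕ} (O : Set (Space m)) : Prop where
  isCompact : IsCompact O
  interior_nonempty : (interior O).Nonempty
  strictConvex : StrictConvex ℝ O
  smooth : HasSmoothBoundary O

/-- The obstacle is small: it lies in a closed ball of radius smaller than `√2 / 4`. -/
def IsSmall {m : ℕ} (O : Set (Space m)) : Prop :=
  ∃ (c : Space m) (r : ℝ), r < √2 / 4 ∧ O ⊆ Metric.closedBall c r

/-- `O_k` is between `O_i` and `O_j`. -/
def IsBetween {m : ℕ} (O : Set (Space m)) (k i j : Fin m → ℤ) : Prop :=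
  k ≠ i ∧ k ≠ j ∧ (lifted O k ∩ convexHull ℝ (lifted O i ∪ lifted O j)).Nonempty

/-- The finite sequence `k 0, …, k s` of elements of `ℤ^m` is admissible. -/
structure IsAdmissible {m : ℕ} (O : Set (Space m)) (s : ℕ) (k : ℕ → Fin m → ℤ) : Prop where
  zero : k 0 = 0
  ne : ∀ n, n + 1 ≤ s → k (n + 1) ≠ k n
  no_between : ∀ n, n + 1 ≤ s → ∀ j, ¬ IsBetween O j (k n) (k (n + 1))
  not_between : ∀ n, n + 2 ≤ s → ¬ IsBetween O (k (n + 1)) (k n) (k (n + 2))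

/-- `ν` is an outer unit normal vector of the convex set `K` at its boundary point `p`
(it is unique if `K` is a convex body with smooth boundary). -/
def IsOuterUnitNormal {m : ℕ} (K : Set (Space m)) (p ν : Space m) : Prop :=
  p ∈ frontier K ∧ ‖ν‖ = 1 ∧ ∀ y ∈ K, inner ℝ (y - p) ν ≤ 0

/-- A point that arrives with velocity `v` at the boundary point `p` of `K` is reflected there,
not tangentially, and leaves with velocity `w`. -/
def IsReflection {m : ℕ} (K : Set (Space m)) (p v w : Space m) : Prop :=
  ∃ ν, IsOuterUnitNormal K p ν ∧ inner ℝ v ν < 0 ∧ w = v - (2 * inner ℝ v ν) • ν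

/-- A piece of a billiard trajectory in the lifting, of type `(k 0, …, k s)`: it starts at the
point `x 0` of the boundary of `O_{k 0}` and reflects consecutively from `O_{k 1}, …, O_{k s}`
at the points `x 1, …, x s`, where it ends. The velocity between `x n` and `x (n + 1)` is the
unit vector `v n`, and `τ n` is the time (and length) of this flight, which does not enter the
interior of any lifted obstacle. -/
structure IsTrajectoryPiece {m : ℕ} (O : Set (Space m)) (s : ℕ) (k : ℕ → Fin m → ℤ)
    (x v : ℕ → Space m) (τ : ℕ → ℝ) : Prop where
  start_mem : x 0 ∈ frontier (lifted O (k 0))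
  time_pos : ∀ n < s, 0 < τ n
  speed : ∀ n < s, ‖v n‖ = 1
  flight : ∀ n < s, x (n + 1) = x n + τ n • v n
  free : ∀ n < s, ∀ j, Disjoint (segment ℝ (x n) (x (n + 1))) (interior (lifted O j))
  reflection : ∀ n < s, IsReflection (lifted O (k (n + 1))) (x (n + 1)) (v n) (v (n + 1))

/-- There is a trajectory piece of admissible type of length `t`, from `a` to `b`. -/
def ExistsAdmissiblePiece {m : ℕ} (O : Set (Space m)) (a b : Space m) (t : ℝ) : Prop :=
  ∃ (s : ℕ) (k : ℕ → Fin m → ℤ) (x v : ℕ → Space m) (τ : ℕ → ℝ),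
    IsAdmissible O s k ∧ IsTrajectoryPiece O s k x v τ ∧
      x 0 = a ∧ x s = b ∧ ∑ n ∈ Finset.range s, τ n = t

/-- The admissible rotation set `AR`. -/
def admissibleRotationSet {m : ℕ} (O : Set (Space m)) : Set (Space m) :=
  {u | ∃ (a b : ℕ → Space m) (t : ℕ → ℝ),
    (∀ n, ExistsAdmissiblePiece O (a n) (b n) (t n)) ∧
      Filter.Tendsto t Filter.atTop Filter.atTop ∧
      Filter.Tendsto (fun n => (t n)⁻¹ • (b n - a n)) Filter.atTop (nhds u)}

end TorusBilliard

/-! An admissible type is realised by a shortest broken line with vertices in the prescribed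
obstacles: first-order minimality at a vertex is the reflection law, and admissibility excludes
collinear corners and obstacles in the way (`IsShortest.isTrajectoryPiece`).

Admissible types come from lattice walks whose steps have coordinates in {-1, 0, 1} and whose
consecutive steps have nonpositive inner product. The lattice points to be avoided are then at
distance at least √2/2, which exceeds the diameter of the obstacle (`IsWalk.isAdmissible`). The
length of the shortest line is at most that of the walk, and stepping back and forth uses up any
missing length without moving far (`IsWalk.exists_piece`).

It remains to reach `N • v` by a walk of length at most `N`, up to bounded errors. Costs of such
walks are subadditive and positively homogeneous (`Achievable`). A sign vector supported on `S`
costs at most √2·√|S|. Cutting |v| into layers over its largest coordinates, Abel summation and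
Cauchy–Schwarz bound the cost of `v` by ‖v‖√((ln m + 5)/2) (`achievable_of_norm`), which is at most
1 on the ball. -/

namespace TorusBilliard

/-! ### First-order conditions for sums of two distances -/

section FirstOrder

variable {E : Type*} [NormedAddCommGroup E] [InnerProductSpace ℝ E]

/-- This is 2‖p‖‖p + th‖ ≤ ‖p‖² + ‖p + th‖²; an explicit quadratic error replaces differentiation of
the norm. -/
theorem norm_add_smul_le {p : E} (hp : p ≠ 0) (h : E) (t : ℝ) :
    ‖p + t • h‖ ≤ ‖p‖ + t * inner ℝ (‖p‖⁻¹ • p) h + t ^ 2 * (‖h‖ ^ 2 / (2 * ‖p‖)) := by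
  have hp' : 0 < ‖p‖ := norm_pos_iff.2 hp
  have hsq : ‖p + t • h‖ ^ 2 = ‖p‖ ^ 2 + 2 * (t * inner ℝ p h) + t ^ 2 * ‖h‖ ^ 2 := by
    rw [norm_add_sq_real, inner_smul_right, norm_smul, mul_pow, Real.norm_eq_abs, sq_abs]
  have hamgm : 2 * ‖p‖ * ‖p + t • h‖ ≤ ‖p‖ ^ 2 + ‖p + t • h‖ ^ 2 := by
    nlinarith [sq_nonneg (‖p‖ - ‖p + t • h‖)]
  have hrhs : ‖p‖ + t * inner ℝ (‖p‖⁻¹ • p) h + t ^ 2 * (‖h‖ ^ 2 / (2 * ‖p‖)) =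
      (‖p‖ ^ 2 + ‖p + t • h‖ ^ 2) / (2 * ‖p‖) := by
    rw [hsq, real_inner_smul_left]
    field_simp
    ring
  rw [hrhs, le_div_iff₀ (by positivity)]
  linarith

theorem inner_nonneg_of_forall_norm_add_le {p q h : E} (hp : p ≠ 0) (hq : q ≠ 0)
    (hmin : ∀ t : ℝ, 0 ≤ t → t ≤ 1 → ‖p‖ + ‖q‖ ≤ ‖p + t • h‖ + ‖q + t • h‖) :
    0 ≤ inner ℝ (‖p‖⁻¹ • p + ‖q‖⁻¹ • q) h := by
  by_contra! hneg
  set a := inner ℝ (‖p‖⁻¹ • p + ‖q‖⁻¹ • q) h with ha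
  set c := ‖h‖ ^ 2 / (2 * ‖p‖) + ‖h‖ ^ 2 / (2 * ‖q‖) with hc
  have hc0 : 0 ≤ c := by positivity
  have key : ∀ t : ℝ, 0 ≤ t → t ≤ 1 → 0 ≤ t * a + t ^ 2 * c := by
    intro t h0 h1
    have h2 := hmin t h0 h1
    have h3 := norm_add_smul_le hp h t
    have h4 := norm_add_smul_le hq h t
    rw [ha, hc, inner_add_left]
    linarith
  have hpos : 0 < -a + c := by linarith
  -- This `t` is at most 1/2 and satisfies `t * c ≤ -a / 2`, so the linear term wins; adding `-a` to
  -- `c` keeps the denominator positive even if `c = 0`.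
  have ht := key (-a / (2 * (-a + c))) (by apply div_nonneg <;> linarith)
    (by rw [div_le_one (by positivity)]; linarith)
  have ht0 : 0 < -a / (2 * (-a + c)) := by apply div_pos <;> linarith
  have hfin : a + -a / (2 * (-a + c)) * c < 0 := by
    have : -a / (2 * (-a + c)) * c ≤ -a / 2 := by
      rw [div_mul_eq_mul_div, div_le_iff₀ (by positivity)]
      nlinarith
    linarith
  nlinarith

end FirstOrder

/-! ### Outer normals and the reflection law -/

section Normal

variable {m : ℕ}

theorem inner_neg_of_mem_interior {K : Set (Space m)} {p ν : Space m} (hν : ‖ν‖ = 1)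
    (h : ∀ y ∈ K, inner ℝ (y - p) ν ≤ 0) {y : Space m} (hy : y ∈ interior K) :
    inner ℝ (y - p) ν < 0 := by
  obtain ⟨ε, hε, hball⟩ := Metric.isOpen_iff.1 isOpen_interior y hy
  have hmem : y + (ε / 2) • ν ∈ K := by
    apply interior_subset
    apply hball
    rw [Metric.mem_ball, dist_eq_norm, add_sub_cancel_left, norm_smul, hν, Real.norm_eq_abs,
      abs_of_pos (by positivity)]
    linarith
  have h1 := h _ hmem
  rw [add_sub_right_comm, inner_add_left, real_inner_smul_left, real_inner_self_eq_norm_sq, hν]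
    at h1
  linarith

theorem isOuterUnitNormal_of_forall {K : Set (Space m)} {p ν : Space m} (hp : p ∈ K)
    (hν : ‖ν‖ = 1) (h : ∀ y ∈ K, inner ℝ (y - p) ν ≤ 0) : IsOuterUnitNormal K p ν := by
  refine ⟨⟨subset_closure hp, fun hint => ?_⟩, hν, h⟩
  have := inner_neg_of_mem_interior hν h hint
  simp at this

/-- A ray that leaves the boundary point `p` on the outer side does not meet the interior. -/
theorem IsOuterUnitNormal.notMem_interior {K : Set (Space m)} {p ν y : Space m}
    (h : IsOuterUnitNormal K p ν) (hy : 0 ≤ inner ℝ (y - p) ν) : y ∉ interior K :=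
  fun hint => absurd (inner_neg_of_mem_interior h.2.1 h.2.2 hint) (not_lt.2 hy)

/-- A broken line with distinct unit velocities `v`, `w` at `p ∈ K` whose corner is
first-order minimal over `K` is reflected at `p`. -/
theorem reflection_of_inner_nonneg {K : Set (Space m)} {p v w : Space m} (hp : p ∈ K)
    (hv : ‖v‖ = 1) (hw : ‖w‖ = 1) (hne : v ≠ w) (h : ∀ y ∈ K, 0 ≤ inner ℝ (v - w) (y - p)) :
    ∃ ν, IsOuterUnitNormal K p ν ∧ inner ℝ v ν < 0 ∧ 0 < inner ℝ w ν ∧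
      w = v - (2 * inner ℝ v ν) • ν := by
  have hd : 0 < ‖v - w‖ := norm_pos_iff.2 (sub_ne_zero.2 hne)
  have hsq : ‖v - w‖ ^ 2 = 2 - 2 * inner ℝ v w := by
    rw [norm_sub_sq_real, hv, hw]; ring
  have hvn : inner ℝ v (-‖v - w‖⁻¹ • (v - w)) = -‖v - w‖ / 2 := by
    rw [inner_smul_right, inner_sub_right, real_inner_self_eq_norm_sq, hv]
    field_simp
    linarith
  have hwn : inner ℝ w (-‖v - w‖⁻¹ • (v - w)) = ‖v - w‖ / 2 := by
    rw [inner_smul_right, inner_sub_right, real_inner_self_eq_norm_sq, hw, real_inner_comm]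
    field_simp
    linarith
  -- For unit vectors, the reflection exchanging `v` and `w` has its mirror orthogonal to `v - w`.
  refine ⟨-‖v - w‖⁻¹ • (v - w), isOuterUnitNormal_of_forall hp ?_ ?_, ?_, ?_, ?_⟩
  · rw [norm_smul, norm_neg, norm_inv, norm_norm, inv_mul_cancel₀ hd.ne']
  · intro y hy
    rw [inner_smul_right, real_inner_comm]
    have := mul_nonneg (inv_nonneg.2 hd.le) (h y hy)
    linarith
  · rw [hvn]; linarith
  · rw [hwn]; linarith
  · rw [hvn, smul_smul]
    have : 2 * (-‖v - w‖ / 2) * -‖v - w‖⁻¹ = 1 := by field_simp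
    rw [this, one_smul, sub_sub_cancel]

end Normal

/-! ### Lattice vectors and translated obstacles -/

section Lattice

variable {m : ℕ}

@[simp] theorem latticeVec_apply (k : Fin m → ℤ) (i : Fin m) : latticeVec k i = (k i : ℝ) := rfl

@[simp] theorem latticeVec_zero : latticeVec (0 : Fin m → ℤ) = 0 := by ext i; simp

theorem latticeVec_add (k l : Fin m → ℤ) : latticeVec (k + l) = latticeVec k + latticeVec l := by
  ext i; simp

theorem latticeVec_sub (k l : Fin m → ℤ) : latticeVec (k - l) = latticeVec k - latticeVec l := by
  ext i; simp

theorem norm_sq_latticeVec (k : Fin m → ℤ) : ‖latticeVec k‖ ^ 2 = ((k ⬝ᵥ k : ℤ) : ℝ) := by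
  rw [EuclideanSpace.real_norm_sq_eq]
  simp [dotProduct, sq]

theorem inner_latticeVec (k l : Fin m → ℤ) :
    inner ℝ (latticeVec k) (latticeVec l) = ((k ⬝ᵥ l : ℤ) : ℝ) := by
  simp [PiLp.inner_apply, dotProduct, mul_comm]

theorem one_le_norm_latticeVec {k : Fin m → ℤ} (hk : k ≠ 0) : 1 ≤ ‖latticeVec k‖ := by
  have h1 : (1 : ℤ) ≤ k ⬝ᵥ k := by
    have h0 : 0 ≤ k ⬝ᵥ k := Finset.sum_nonneg fun i _ => mul_self_nonneg _
    have : k ⬝ᵥ k ≠ 0 := fun h => hk (dotProduct_self_eq_zero.1 h)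
    omega
  have h2 : (1 : ℝ) ≤ ‖latticeVec k‖ ^ 2 := by
    rw [norm_sq_latticeVec]; exact_mod_cast h1
  nlinarith [norm_nonneg (latticeVec k)]

theorem mem_lifted {O : Set (Space m)} {k : Fin m → ℤ} {x : Space m} :
    x ∈ lifted O k ↔ x - latticeVec k ∈ O := by
  constructor
  · rintro ⟨y, hy, rfl⟩
    simpa using hy
  · intro h
    exact ⟨_, h, by simp⟩

theorem isCompact_lifted {O : Set (Space m)} (hO : IsCompact O) (k : Fin m → ℤ) :
    IsCompact (lifted O k) :=
  hO.image (by fun_prop)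

theorem convex_lifted {O : Set (Space m)} (hO : Convex ℝ O) (k : Fin m → ℤ) :
    Convex ℝ (lifted O k) :=
  hO.translate _

theorem segment_subset_hull {O : Set (Space m)} {i j : Fin m → ℤ} {x y : Space m}
    (hx : x ∈ lifted O i) (hy : y ∈ lifted O j) :
    segment ℝ x y ⊆ convexHull ℝ (lifted O i ∪ lifted O j) :=
  segment_subset_convexHull (Or.inl hx) (Or.inr hy)

/-- If `O_k` is between `O_i` and `O_j`, then `k` is close to the segment from `i` to `j`. -/
theorem IsBetween.exists_dist_lt {O : Set (Space m)} (hconv : Convex ℝ O) {D : ℝ}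
    (hdiam : ∀ x ∈ O, ∀ y ∈ O, dist x y ≤ D) {k i j : Fin m → ℤ} (h : IsBetween O k i j) :
    ∃ t : ℝ, 0 ≤ t ∧ t ≤ 1 ∧
      ‖t • latticeVec (j - i) - latticeVec (k - i)‖ ≤ D := by
  obtain ⟨-, -, z, hzk, hz⟩ := h
  rw [mem_lifted] at hzk
  have hO : O.Nonempty := ⟨_, hzk⟩
  rw [(convex_lifted hconv i).convexHull_union (convex_lifted hconv j) (hO.image _) (hO.image _),
    mem_convexJoin] at hz
  obtain ⟨a, ha, b, hb, α, β, hα, hβ, hαβ, rfl⟩ := hz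
  rw [mem_lifted] at ha hb
  -- Translating `a` and `b` back to `O` gives a second point of `O` besides `z - latticeVec k`;
  -- their difference is purely a lattice expression.
  have h1 := hconv ha hb hα hβ hαβ
  refine ⟨β, hβ, by linarith, ?_⟩
  have h2 := hdiam _ hzk _ h1
  rw [dist_eq_norm] at h2
  refine le_of_eq_of_le (congrArg norm ?_) h2
  obtain rfl : α = 1 - β := by linarith
  rw [latticeVec_sub, latticeVec_sub]
  module

end Lattice

/-! ### Shortest broken lines are trajectory pieces -/

section ShortestPath

variable {m : ℕ} {O : Set (Space m)} {k : ℕ → Fin m → ℤ} {s : ℕ} {x : ℕ → Space m}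

/-- The length of the broken line `x 0, …, x s`. -/
noncomputable def pathLength (s : ℕ) (x : ℕ → Space m) : ℝ :=
  ∑ n ∈ Finset.range s, dist (x n) (x (n + 1))

theorem pathLength_succ (s : ℕ) (x : ℕ → Space m) :
    pathLength (s + 1) x = pathLength s x + dist (x s) (x (s + 1)) :=
  Finset.sum_range_succ _ _

theorem pathLength_congr {y : ℕ → Space m} (h : ∀ n ≤ s, x n = y n) :
    pathLength s x = pathLength s y := by
  refine Finset.sum_congr rfl fun n hn => ?_
  rw [Finset.mem_range] at hn
  rw [h n hn.le, h (n + 1) hn]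

/-- The broken line `x 0, …, x s` is a shortest one with vertices in the obstacles
`O_{k 0}, …, O_{k s}`. -/
structure IsShortest (O : Set (Space m)) (k : ℕ → Fin m → ℤ) (s : ℕ) (x : ℕ → Space m) :
    Prop where
  mem : ∀ n, x n ∈ lifted O (k n)
  le : ∀ y : ℕ → Space m, (∀ n, y n ∈ lifted O (k n)) → pathLength s x ≤ pathLength s y

/-- Tychonoff gives compactness of the space of infinite vertex sequences; vertices beyond `s` do
not affect the length. -/
theorem exists_isShortest (hO : IsCompact O) (hne : O.Nonempty) (k : ℕ → Fin m → ℤ) (s : ℕ) :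
    ∃ x, IsShortest O k s x := by
  have hc : IsCompact (Set.pi Set.univ fun n => lifted O (k n)) :=
    isCompact_univ_pi fun n => isCompact_lifted hO (k n)
  have hn : (Set.pi Set.univ fun n => lifted O (k n)).Nonempty :=
    Set.univ_pi_nonempty_iff.2 fun n => hne.image _
  have hcont : Continuous (pathLength s : (ℕ → Space m) → ℝ) := by
    unfold pathLength
    fun_prop
  obtain ⟨x, hx, hmin⟩ := hc.exists_isMinOn hn hcont.continuousOn
  exact ⟨x, fun n => hx n trivial, fun y hy => hmin (fun n _ => hy n)⟩

/-- Moving a single vertex changes only the adjacent sides, so all other summands vanish in the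
three consequences below. -/
theorem IsShortest.sum_nonneg (h : IsShortest O k s x) (n : ℕ) {y : Space m}
    (hy : y ∈ lifted O (k n)) :
    0 ≤ ∑ i ∈ Finset.range s, (dist (Function.update x n y i) (Function.update x n y (i + 1)) -
      dist (x i) (x (i + 1))) := by
  rw [Finset.sum_sub_distrib, sub_nonneg]
  refine h.le _ fun i => ?_
  rcases eq_or_ne i n with rfl | hi
  · simpa using hy
  · simpa [Function.update_of_ne hi] using h.mem i

theorem IsShortest.dist_le_first (h : IsShortest O k s x) (hs : 0 < s) {y : Space m}
    (hy : y ∈ lifted O (k 0)) : dist (x 0) (x 1) ≤ dist y (x 1) := by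
  have h1 := h.sum_nonneg 0 hy
  rw [Finset.sum_eq_single_of_mem 0 (Finset.mem_range.2 hs)] at h1
  · simpa using h1
  · intro i _ hi
    simp [Function.update_of_ne hi]

theorem IsShortest.dist_le_last (h : IsShortest O k (s + 1) x) {y : Space m}
    (hy : y ∈ lifted O (k (s + 1))) : dist (x s) (x (s + 1)) ≤ dist (x s) y := by
  have h1 := h.sum_nonneg (s + 1) hy
  rw [Finset.sum_eq_single_of_mem s (Finset.self_mem_range_succ s)] at h1
  · simpa [Function.update_of_ne] using h1
  · intro i hi hi'
    rw [Finset.mem_range] at hi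
    rw [Function.update_of_ne (by omega), Function.update_of_ne (by omega), sub_self]

theorem IsShortest.dist_le_middle (h : IsShortest O k s x) {n : ℕ} (hn : n + 2 ≤ s) {y : Space m}
    (hy : y ∈ lifted O (k (n + 1))) :
    dist (x n) (x (n + 1)) + dist (x (n + 1)) (x (n + 2)) ≤
      dist (x n) y + dist y (x (n + 2)) := by
  have h1 := h.sum_nonneg (n + 1) hy
  rw [Finset.sum_eq_add_of_mem n (n + 1) (Finset.mem_range.2 (by omega))
    (Finset.mem_range.2 (by omega)) (by omega)] at h1
  · rw [Function.update_of_ne (by omega), Function.update_self,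
      Function.update_of_ne (by omega)] at h1
    linarith
  · intro i _ hi
    rw [Function.update_of_ne (by omega), Function.update_of_ne (by omega), sub_self]

/-- The direction of the broken line `x` after its vertex `x n`. -/
noncomputable def direction (x : ℕ → Space m) (n : ℕ) : Space m :=
  ‖x (n + 1) - x n‖⁻¹ • (x (n + 1) - x n)

theorem norm_direction {n : ℕ} (h : x n ≠ x (n + 1)) : ‖direction x n‖ = 1 := by
  have : ‖x (n + 1) - x n‖ ≠ 0 := norm_ne_zero_iff.2 (sub_ne_zero.2 h.symm)
  rw [direction, norm_smul, norm_inv, norm_norm, inv_mul_cancel₀ this]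

theorem dist_smul_direction {n : ℕ} (h : x n ≠ x (n + 1)) :
    dist (x n) (x (n + 1)) • direction x n = x (n + 1) - x n := by
  have : ‖x (n + 1) - x n‖ ≠ 0 := norm_ne_zero_iff.2 (sub_ne_zero.2 h.symm)
  rw [direction, dist_comm, dist_eq_norm, smul_smul, mul_inv_cancel₀ this, one_smul]

theorem segment_point_mem {K : Set (Space m)} (hK : Convex ℝ K) {p y : Space m} (hp : p ∈ K)
    (hy : y ∈ K) {t : ℝ} (h0 : 0 ≤ t) (h1 : t ≤ 1) : p + t • (y - p) ∈ K :=
  hK.add_smul_sub_mem hp hy ⟨h0, h1⟩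

theorem IsShortest.inner_first (hO : Convex ℝ O) (h : IsShortest O k s x) (hs : 0 < s)
    (hne : x 0 ≠ x 1) {y : Space m} (hy : y ∈ lifted O (k 0)) :
    inner ℝ (y - x 0) (direction x 0) ≤ 0 := by
  -- An end vertex has only one side; counting it twice fits the two-distance criterion.
  have h1 := inner_nonneg_of_forall_norm_add_le (p := x 0 - x 1) (q := x 0 - x 1) (h := y - x 0)
    (sub_ne_zero.2 hne) (sub_ne_zero.2 hne) fun t h0 h1 => by
      have := h.dist_le_first hs (segment_point_mem (convex_lifted hO _) (h.mem 0) hy h0 h1)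
      rw [dist_eq_norm, dist_eq_norm, add_sub_right_comm] at this
      linarith
  rw [inner_add_left] at h1
  have h2 : ‖x 0 - x 1‖⁻¹ • (x 0 - x 1) = -direction x 0 := by
    rw [direction, zero_add, norm_sub_rev, ← smul_neg, neg_sub]
  rw [h2, inner_neg_left, real_inner_comm] at h1
  linarith

theorem IsShortest.inner_last (hO : Convex ℝ O) (h : IsShortest O k (s + 1) x)
    (hne : x s ≠ x (s + 1)) {y : Space m} (hy : y ∈ lifted O (k (s + 1))) :
    0 ≤ inner ℝ (direction x s) (y - x (s + 1)) := by
  have h1 := inner_nonneg_of_forall_norm_add_le (p := x (s + 1) - x s) (q := x (s + 1) - x s)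
    (h := y - x (s + 1)) (sub_ne_zero.2 hne.symm) (sub_ne_zero.2 hne.symm) fun t h0 h1 => by
      have := h.dist_le_last (segment_point_mem (convex_lifted hO _) (h.mem (s + 1)) hy h0 h1)
      rw [dist_comm, dist_eq_norm, dist_comm, dist_eq_norm, add_sub_right_comm] at this
      linarith
  rw [inner_add_left] at h1
  rw [direction]
  linarith

theorem IsShortest.inner_middle (hO : Convex ℝ O) (h : IsShortest O k s x) {n : ℕ}
    (hn : n + 2 ≤ s) (hne : x n ≠ x (n + 1)) (hne' : x (n + 1) ≠ x (n + 2)) {y : Space m}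
    (hy : y ∈ lifted O (k (n + 1))) :
    0 ≤ inner ℝ (direction x n - direction x (n + 1)) (y - x (n + 1)) := by
  have h1 := inner_nonneg_of_forall_norm_add_le (p := x (n + 1) - x n)
    (q := x (n + 1) - x (n + 2)) (h := y - x (n + 1))
    (sub_ne_zero.2 hne.symm) (sub_ne_zero.2 hne') fun t h0 h1 => by
      have := h.dist_le_middle hn
        (segment_point_mem (convex_lifted hO _) (h.mem (n + 1)) hy h0 h1)
      rwa [dist_comm (x n), dist_comm (x n), dist_eq_norm, dist_eq_norm, dist_eq_norm,
        dist_eq_norm, add_sub_right_comm, add_sub_right_comm] at this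
  have h2 : ‖x (n + 1) - x (n + 2)‖⁻¹ • (x (n + 1) - x (n + 2)) = -direction x (n + 1) := by
    rw [direction, norm_sub_rev, ← smul_neg, neg_sub]
  rwa [h2, ← sub_eq_add_neg] at h1

/-- Without a change of direction the middle vertex would lie on the segment joining its neighbours,
putting its obstacle between theirs. -/
theorem direction_ne_of_not_isBetween (hmem : ∀ n, x n ∈ lifted O (k n)) {n : ℕ}
    (hne : x n ≠ x (n + 1)) (hne' : x (n + 1) ≠ x (n + 2)) (hk : k (n + 1) ≠ k n)
    (hk' : k (n + 2) ≠ k (n + 1)) (hb : ¬ IsBetween O (k (n + 1)) (k n) (k (n + 2))) :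
    direction x n ≠ direction x (n + 1) := by
  intro heq
  refine hb ⟨hk, hk'.symm, x (n + 1), hmem _, segment_subset_hull (hmem n) (hmem (n + 2)) ?_⟩
  rw [mem_segment_iff_sameRay, ← dist_smul_direction hne, ← dist_smul_direction hne', heq]
  exact (SameRay.sameRay_nonneg_smul_left _ dist_nonneg).nonneg_smul_right dist_nonneg

/-- The velocities of a shortest broken line, followed by its velocity after the last
reflection. -/
noncomputable def velocity (x : ℕ → Space m) (s n : ℕ) : Space m :=
  if n < s then direction x n else -direction x (n - 1)

theorem IsShortest.exists_normal (hO : Convex ℝ O) (hk : IsAdmissible O s k)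
    (h : IsShortest O k s x) (hne : ∀ n < s, x n ≠ x (n + 1)) {n : ℕ} (hn : n < s) :
    ∃ ν, IsOuterUnitNormal (lifted O (k (n + 1))) (x (n + 1)) ν ∧
      inner ℝ (velocity x s n) ν < 0 ∧ 0 < inner ℝ (velocity x s (n + 1)) ν ∧
      velocity x s (n + 1) = velocity x s n - (2 * inner ℝ (velocity x s n) ν) • ν := by
  have hv : ‖direction x n‖ = 1 := norm_direction (hne n hn)
  have hvn : velocity x s n = direction x n := if_pos hn
  rw [hvn]
  rcases lt_or_ge (n + 1) s with hn' | hn'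
  · have hvn' : velocity x s (n + 1) = direction x (n + 1) := if_pos hn'
    rw [hvn']
    exact reflection_of_inner_nonneg (h.mem _) hv (norm_direction (hne _ hn'))
      (direction_ne_of_not_isBetween h.mem (hne n hn) (hne _ hn') (hk.ne n hn)
        (hk.ne (n + 1) hn') (hk.not_between n hn'))
      fun y hy => h.inner_middle hO hn' (hne n hn) (hne _ hn') hy
  -- At the last vertex minimality makes the line hit the obstacle orthogonally, so the reflected
  -- velocity is the reversed one.
  · obtain rfl : s = n + 1 := by omega
    have hvn' : velocity x (n + 1) (n + 1) = -direction x n := if_neg (lt_irrefl _)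
    rw [hvn']
    refine reflection_of_inner_nonneg (h.mem _) hv (by rwa [norm_neg]) ?_ ?_
    · intro heq
      have h1 := congrArg (inner ℝ (direction x n)) heq
      rw [inner_neg_right, real_inner_self_eq_norm_sq, hv] at h1
      norm_num at h1
    · intro y hy
      have := h.inner_last hO (hne n hn) hy
      rw [sub_neg_eq_add, inner_add_left]
      linarith

/-- A flight avoids the interiors of the two obstacles at its ends because it lies on the outer side
of a supporting hyperplane of each; any other obstacle it met would be between these two. -/
theorem IsShortest.isTrajectoryPiece (hO : Convex ℝ O) (hk : IsAdmissible O s k)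
    (h : IsShortest O k s x) (hs : 0 < s) (hne : ∀ n < s, x n ≠ x (n + 1)) :
    IsTrajectoryPiece O s k x (velocity x s) (fun n => dist (x n) (x (n + 1))) := by
  have hfirst : IsOuterUnitNormal (lifted O (k 0)) (x 0) (direction x 0) :=
    isOuterUnitNormal_of_forall (h.mem 0) (norm_direction (hne 0 hs))
      fun y hy => h.inner_first hO hs (hne 0 hs) hy
  have hflight : ∀ n < s, x (n + 1) - x n = dist (x n) (x (n + 1)) • velocity x s n := by
    intro n hn
    rw [velocity, if_pos hn, dist_smul_direction (hne n hn)]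
  have hout : ∀ n < s, ∃ ν, IsOuterUnitNormal (lifted O (k n)) (x n) ν ∧
      0 < inner ℝ (velocity x s n) ν := by
    rintro (_ | n) hn
    · refine ⟨_, hfirst, ?_⟩
      rw [velocity, if_pos hn, real_inner_self_eq_norm_sq, norm_direction (hne 0 hn)]
      norm_num
    · obtain ⟨ν, hν, -, hpos, -⟩ := h.exists_normal hO hk hne (n := n) (by omega)
      exact ⟨ν, hν, hpos⟩
  refine ⟨hfirst.1, fun n hn => dist_pos.2 (hne n hn), fun n hn => ?_, fun n hn => ?_,
    fun n hn j => ?_, fun n hn => ?_⟩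
  · rw [velocity, if_pos hn, norm_direction (hne n hn)]
  · rw [← hflight n hn, add_sub_cancel]
  · rw [Set.disjoint_left]
    intro z hz
    by_cases hj : j = k n
    · obtain ⟨ν, hν, hpos⟩ := hout n hn
      rw [segment_eq_image'] at hz
      obtain ⟨t, ht, rfl⟩ := hz
      subst hj
      apply hν.notMem_interior
      rw [add_sub_cancel_left, hflight n hn, real_inner_smul_left, real_inner_smul_left]
      exact mul_nonneg ht.1 (mul_nonneg dist_nonneg hpos.le)
    by_cases hj' : j = k (n + 1)
    · obtain ⟨ν, hν, hneg, -, -⟩ := h.exists_normal hO hk hne hn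
      rw [segment_symm, segment_eq_image'] at hz
      obtain ⟨t, ht, rfl⟩ := hz
      subst hj'
      apply hν.notMem_interior
      rw [add_sub_cancel_left, ← neg_sub, hflight n hn, real_inner_smul_left, inner_neg_left,
        real_inner_smul_left]
      exact mul_nonneg ht.1 (neg_nonneg.2 (mul_nonpos_of_nonneg_of_nonpos dist_nonneg hneg.le))
    · exact fun hint => hk.no_between n hn j
        ⟨hj, hj', z, interior_subset hint, segment_subset_hull (h.mem n) (h.mem (n + 1)) hz⟩
  · obtain ⟨ν, hν, hneg, -, heq⟩ := h.exists_normal hO hk hne hn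
    exact ⟨ν, hν, hneg, heq⟩

theorem IsShortest.existsAdmissiblePiece (hO : Convex ℝ O) (hk : IsAdmissible O s k)
    (h : IsShortest O k s x) (hs : 0 < s) (hne : ∀ n < s, x n ≠ x (n + 1)) :
    ExistsAdmissiblePiece O (x 0) (x s) (pathLength s x) :=
  ⟨s, k, x, _, _, hk, h.isTrajectoryPiece hO hk hs hne, rfl, rfl, rfl⟩

/-- The competitor prolongs `x` by carrying its last vertex along with the translated obstacle. -/
theorem IsShortest.pathLength_succ_le {y : ℕ → Space m} (h : IsShortest O k s x)
    (h' : IsShortest O k (s + 1) y) :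
    pathLength (s + 1) y ≤ pathLength s x + ‖latticeVec (k (s + 1) - k s)‖ := by
  have h1 := h'.le (Function.update x (s + 1) (x s + latticeVec (k (s + 1) - k s))) fun n => by
    rcases eq_or_ne n (s + 1) with rfl | hn
    · rw [Function.update_self, mem_lifted, latticeVec_sub]
      have := mem_lifted.1 (h.mem s)
      convert this using 1
      abel
    · rw [Function.update_of_ne hn]
      exact h.mem n
  rw [pathLength_succ s (Function.update _ _ _), Function.update_self,
    Function.update_of_ne (by omega), dist_self_add_right,
    pathLength_congr (s := s) (y := x)] at h1
  · exact h1
  · intro n hn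
    rw [Function.update_of_ne (by omega)]

end ShortestPath

/-! ### Lattice walks with admissible itineraries -/

section Walk

variable {m : ℕ} {O : Set (Space m)}

/-- The steps from an obstacle to a neighbouring one: the non-zero vectors with coordinates
`-1`, `0`, `1`. -/
structure IsStep (d : Fin m → ℤ) : Prop where
  ne_zero : d ≠ 0
  coord : ∀ i, d i = -1 ∨ d i = 0 ∨ d i = 1

theorem IsStep.neg {d : Fin m → ℤ} (h : IsStep d) : IsStep (-d) := by
  refine ⟨neg_ne_zero.2 h.ne_zero, fun i => ?_⟩
  have := h.coord i
  simp only [Pi.neg_apply]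
  omega

theorem IsStep.norm_le {d : Fin m → ℤ} (h : IsStep d) : ‖latticeVec d‖ ≤ √m := by
  apply Real.le_sqrt_of_sq_le
  rw [norm_sq_latticeVec]
  have : d ⬝ᵥ d ≤ ∑ _i : Fin m, (1 : ℤ) := Finset.sum_le_sum fun i _ => by
    rcases h.coord i with h | h | h <;> simp [h]
  rw [Finset.sum_const, Finset.card_univ, Fintype.card_fin, nsmul_one] at this
  exact_mod_cast this

theorem one_le_sq_sub_of_ne {a b : ℤ} (h : a ≠ b) : (1 : ℝ) ≤ ((a : ℝ) - b) ^ 2 := by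
  have : (1 : ℤ) ≤ (a - b) ^ 2 := by
    have : 0 < (a - b) ^ 2 := by have := sub_ne_zero.2 h; positivity
    omega
  exact_mod_cast this

/-- The segment along a step stays far from all other lattice points. -/
theorem IsStep.half_le_norm_sq {d c : Fin m → ℤ} (hd : IsStep d) (hc : c ≠ 0) (hcd : c ≠ d)
    {t : ℝ} (h0 : 0 ≤ t) (h1 : t ≤ 1) :
    1 / 2 ≤ ‖t • latticeVec d - latticeVec c‖ ^ 2 := by
  rw [EuclideanSpace.real_norm_sq_eq]
  simp only [PiLp.sub_apply, PiLp.smul_apply, latticeVec_apply, smul_eq_mul]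
  by_contra! hlt
  have hterm : ∀ i, (t * (d i : ℝ) - c i) ^ 2 < 1 / 2 := fun i =>
    (Finset.single_le_sum (f := fun i => (t * (d i : ℝ) - c i) ^ 2) (fun i _ => sq_nonneg _)
      (Finset.mem_univ i)).trans_lt hlt
  have hpair : ∀ i j, i ≠ j → (t * (d i : ℝ) - c i) ^ 2 + (t * (d j : ℝ) - c j) ^ 2 < 1 / 2 := by
    intro i j hij
    rw [← Finset.sum_pair (f := fun i => (t * (d i : ℝ) - c i) ^ 2) hij]
    exact (Finset.sum_le_sum_of_subset_of_nonneg (Finset.subset_univ _)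
      fun i _ _ => sq_nonneg _).trans_lt hlt
  have hzero : ∀ i, d i = 0 → c i = 0 := by
    intro i hi
    by_contra hci
    have h2 := hterm i
    have h3 := one_le_sq_sub_of_ne hci
    rw [hi] at h2
    push_cast at h2 h3
    nlinarith
  -- Since `d i = ±1`, the question becomes how far `t` is from the integers `d i * c i`. Two
  -- distinct ones `a`, `b` contribute at least (a - b)²/2 ≥ 1/2, so all agree and `c` is a multiple
  -- of `d`.
  have hsq : ∀ i, d i ≠ 0 → (t * (d i : ℝ) - c i) ^ 2 = (t - (d i * c i : ℤ)) ^ 2 := by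
    intro i hi
    rcases hd.coord i with h | h | h
    · rw [h]; push_cast; ring
    · exact absurd h hi
    · rw [h]; push_cast; ring
  obtain ⟨i, hi⟩ := Function.ne_iff.1 hd.ne_zero
  simp only [Pi.zero_apply] at hi
  have hall : ∀ j, d j ≠ 0 → d j * c j = d i * c i := by
    intro j hj
    by_contra hne
    have hij : j ≠ i := by rintro rfl; exact hne rfl
    have h2 := hpair j i hij
    rw [hsq i hi, hsq j hj] at h2
    have h3 := one_le_sq_sub_of_ne hne
    nlinarith [sq_nonneg (2 * t - (d j * c j : ℤ) - (d i * c i : ℤ))]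
  have hcq : ∀ j, c j = d i * c i * d j := by
    intro j
    by_cases hj : d j = 0
    · rw [hj, hzero j hj, mul_zero]
    · rw [← hall j hj]
      rcases hd.coord j with h | h | h
      · rw [h]; ring
      · exact absurd h hj
      · rw [h]; ring
  -- The multiple is neither 0 nor 1, hence at distance at least 1 from `t ∈ [0, 1]`.
  have hq0 : d i * c i ≠ 0 := fun h => hc (funext fun j => by rw [hcq j, h]; simp)
  have hq1 : d i * c i ≠ 1 := fun h => hcd (funext fun j => by rw [hcq j, h, one_mul])
  have h2 := hterm i
  rw [hsq i hi] at h2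
  rcases lt_or_gt_of_ne hq0 with h | h
  · have : ((d i * c i : ℤ) : ℝ) ≤ -1 := by exact_mod_cast Int.le_sub_one_of_lt h
    nlinarith
  · have : (2 : ℝ) ≤ ((d i * c i : ℤ) : ℝ) := by
      have : 2 ≤ d i * c i := by omega
      exact_mod_cast this
    nlinarith

/-- The corner of two steps that form no obtuse turn is far from the opposite side. -/
theorem half_le_norm_sq_corner {e f : Fin m → ℤ} (he : e ≠ 0) (hf : f ≠ 0) (hef : e ⬝ᵥ f ≤ 0)
    {t : ℝ} (h0 : 0 ≤ t) (h1 : t ≤ 1) :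
    1 / 2 ≤ ‖t • latticeVec (e + f) - latticeVec e‖ ^ 2 := by
  have heq : t • latticeVec (e + f) - latticeVec e = t • latticeVec f - (1 - t) • latticeVec e := by
    rw [latticeVec_add]; module
  have hin : inner ℝ (latticeVec f) (latticeVec e) ≤ (0 : ℝ) := by
    rw [real_inner_comm, inner_latticeVec]; exact_mod_cast hef
  rw [heq, norm_sub_sq_real, norm_smul, norm_smul, real_inner_smul_left, inner_smul_right,
    Real.norm_eq_abs, Real.norm_eq_abs, abs_of_nonneg h0, abs_of_nonneg (sub_nonneg.2 h1)]
  have he1 := one_le_norm_latticeVec he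
  have hf1 := one_le_norm_latticeVec hf
  have h2 : t ≤ t * ‖latticeVec f‖ := le_mul_of_one_le_right h0 hf1
  have h3 : 1 - t ≤ (1 - t) * ‖latticeVec e‖ := le_mul_of_one_le_right (sub_nonneg.2 h1) he1
  have h4 : t * ((1 - t) * inner ℝ (latticeVec f) (latticeVec e)) ≤ 0 :=
    mul_nonpos_of_nonneg_of_nonpos h0 (mul_nonpos_of_nonneg_of_nonpos (sub_nonneg.2 h1) hin)
  -- The bound is t² + (1 - t)² ≥ 1/2.
  nlinarith [sq_nonneg (2 * t - 1), pow_le_pow_left₀ h0 h2 2,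
    pow_le_pow_left₀ (sub_nonneg.2 h1) h3 2]

/-- The sequence of steps `d` never turns by an acute angle. -/
structure IsWalk (d : ℕ → Fin m → ℤ) : Prop where
  step : ∀ n, IsStep (d n)
  turn : ∀ n, d n ⬝ᵥ d (n + 1) ≤ 0

/-- The position after the first `n` of the steps `d`. -/
def position (d : ℕ → Fin m → ℤ) (n : ℕ) : Fin m → ℤ := ∑ i ∈ Finset.range n, d i

theorem position_succ (d : ℕ → Fin m → ℤ) (n : ℕ) : position d (n + 1) = position d n + d n :=
  Finset.sum_range_succ _ _

theorem position_succ_sub (d : ℕ → Fin m → ℤ) (n : ℕ) :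
    position d (n + 1) - position d n = d n := by
  rw [position_succ, add_sub_cancel_left]

theorem IsWalk.isAdmissible (hO : Convex ℝ O) {D : ℝ} (hD : D ^ 2 < 1 / 2)
    (hdiam : ∀ x ∈ O, ∀ y ∈ O, dist x y ≤ D) {d : ℕ → Fin m → ℤ} (hd : IsWalk d) (s : ℕ) :
    IsAdmissible O s (position d) := by
  have hlt : ∀ z : Space m, ‖z‖ ≤ D → ‖z‖ ^ 2 < 1 / 2 := fun z hz =>
    (pow_le_pow_left₀ (norm_nonneg z) hz 2).trans_lt hD
  refine ⟨Finset.sum_range_zero _, fun n _ h => ?_, fun n _ j hj => ?_, fun n _ h => ?_⟩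
  · exact (hd.step n).ne_zero (by rw [← position_succ_sub d n, h, sub_self])
  · obtain ⟨t, h0, h1, ht⟩ := hj.exists_dist_lt hO hdiam
    rw [position_succ_sub] at ht
    refine absurd (hlt _ ht) (not_lt.2 ((hd.step n).half_le_norm_sq ?_ ?_ h0 h1))
    · exact sub_ne_zero.2 hj.1
    · intro h
      exact hj.2.1 (by rw [position_succ, ← h, add_sub_cancel])
  · obtain ⟨t, h0, h1, ht⟩ := h.exists_dist_lt hO hdiam
    rw [position_succ_sub, position_succ, position_succ, add_assoc, add_sub_cancel_left] at ht
    exact absurd (hlt _ ht) (not_lt.2 (half_le_norm_sq_corner (hd.step n).ne_zero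
      (hd.step (n + 1)).ne_zero (hd.turn n) h0 h1))

/-- Obstacles of diameter at most `D` have distance at least `1 - D`. -/
theorem one_sub_le_dist {D : ℝ} (hdiam : ∀ x ∈ O, ∀ y ∈ O, dist x y ≤ D) {i j : Fin m → ℤ}
    (hij : i ≠ j) {x y : Space m} (hx : x ∈ lifted O i) (hy : y ∈ lifted O j) :
    1 - D ≤ dist x y := by
  have h1 := hdiam _ (mem_lifted.1 hx) _ (mem_lifted.1 hy)
  have h2 := one_le_norm_latticeVec (sub_ne_zero.2 hij)
  have h3 : latticeVec (i - j) = (x - y) - ((x - latticeVec i) - (y - latticeVec j)) := by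
    rw [latticeVec_sub]; abel
  rw [h3] at h2
  have h4 := norm_sub_le (x - y) ((x - latticeVec i) - (y - latticeVec j))
  rw [dist_eq_norm] at h1 ⊢
  linarith

/-- Along a walk, there are trajectory pieces of every prescribed length, up to a bounded error. -/
theorem IsWalk.exists_piece (hO : Convex ℝ O) (hcomp : IsCompact O) (hne : O.Nonempty) {D : ℝ}
    (hD0 : 0 ≤ D) (hD : D ^ 2 < 1 / 2) (hdiam : ∀ x ∈ O, ∀ y ∈ O, dist x y ≤ D)
    {d : ℕ → Fin m → ℤ} (hd : IsWalk d) (s : ℕ) {T C : ℝ} (hT : 0 < T) (hC : 0 ≤ C)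
    (hs : ∑ i ∈ Finset.range s, ‖latticeVec (d i)‖ ≤ T + C) :
    ∃ (n : ℕ) (a b : Space m) (t : ℝ), s ≤ n ∧ ExistsAdmissiblePiece O a b t ∧
      T ≤ t ∧ t ≤ T + C + √m ∧ ‖b - a - latticeVec (position d n)‖ ≤ D := by
  have hD1 : D < 1 := by nlinarith
  choose x hx using exists_isShortest hcomp hne (position d)
  have hstep : ∀ n, pathLength (n + 1) (x (n + 1)) ≤ pathLength n (x n) + ‖latticeVec (d n)‖ := by
    intro n
    have := (hx n).pathLength_succ_le (hx (n + 1))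
    rwa [position_succ_sub] at this
  have hupper : ∀ n, pathLength n (x n) ≤ ∑ i ∈ Finset.range n, ‖latticeVec (d i)‖ := by
    intro n
    induction n with
    | zero => simp [pathLength]
    | succ n ih => rw [Finset.sum_range_succ]; linarith [hstep n]
  have hadm := fun n => hd.isAdmissible hO hD hdiam n
  have hgap : ∀ n i, 1 - D ≤ dist (x n i) (x n (i + 1)) := fun n i =>
    one_sub_le_dist hdiam ((hadm (i + 1)).ne i le_rfl).symm ((hx n).mem i) ((hx n).mem (i + 1))
  have hlower : ∀ n : ℕ, n * (1 - D) ≤ pathLength n (x n) := by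
    intro n
    have := Finset.card_nsmul_le_sum (Finset.range n) _ _ fun i _ => hgap n i
    rwa [Finset.card_range, nsmul_eq_mul] at this
  -- The walk is stopped at the first such `n`. If `n = s`, the length is bounded by that of the
  -- walk; otherwise the previous length was below `T`, and one step adds at most `√m`.
  have hex : ∃ n, s ≤ n ∧ T ≤ pathLength n (x n) := by
    obtain ⟨n, hn⟩ := exists_nat_ge (T / (1 - D))
    refine ⟨max s n, le_max_left _ _, le_trans ?_ (hlower _)⟩
    rw [div_le_iff₀ (by linarith)] at hn
    refine hn.trans (mul_le_mul_of_nonneg_right ?_ (by linarith))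
    exact_mod_cast le_max_right s n
  classical
  obtain ⟨hsn, hTn⟩ := Nat.find_spec hex
  set n := Nat.find hex with hn
  have hn0 : 0 < n := by
    rcases Nat.eq_zero_or_pos n with h | h
    · rw [h] at hTn
      simp only [pathLength, Finset.range_zero, Finset.sum_empty] at hTn
      linarith
    · exact h
  refine ⟨n, x n 0, x n n, pathLength n (x n), hsn,
    (hx n).existsAdmissiblePiece hO (hadm n) hn0 fun i _ h => ?_, hTn, ?_, ?_⟩
  · have := hgap n i
    rw [h, dist_self] at this
    linarith
  · rcases hsn.eq_or_lt with h | h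
    · have := hupper n
      rw [← h] at this ⊢
      linarith [Real.sqrt_nonneg m]
    · obtain ⟨p, hp⟩ : ∃ p, n = p + 1 := ⟨n - 1, by omega⟩
      have hmin := Nat.find_min hex (m := p) (by omega)
      have hlt : pathLength p (x p) < T := by
        by_contra! hle
        exact hmin ⟨by omega, hle⟩
      rw [hp]
      linarith [hstep p, (hd.step p).norm_le]
  · have h0 := mem_lifted.1 ((hx n).mem 0)
    have h1 := hdiam _ (mem_lifted.1 ((hx n).mem n)) _ h0
    rw [(hadm n).zero, latticeVec_zero, sub_zero, dist_eq_norm] at h1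
    refine le_of_eq_of_le (congrArg norm ?_) h1
    abel

/-- Position and time are both right up to bounded errors, which vanish after division by the time.
The position bound is needed for all `n ≥ s` because the stopping index is not controlled. -/
theorem mem_admissibleRotationSet_of_walks (hO : Convex ℝ O) (hcomp : IsCompact O)
    (hne : O.Nonempty) {D : ℝ} (hD0 : 0 ≤ D) (hD : D ^ 2 < 1 / 2)
    (hdiam : ∀ x ∈ O, ∀ y ∈ O, dist x y ≤ D) {v : Space m} {C : ℝ} (hC : 0 ≤ C)
    (h : ∀ N : ℕ, ∃ (d : ℕ → Fin m → ℤ) (s : ℕ), IsWalk d ∧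
      ∑ i ∈ Finset.range s, ‖latticeVec (d i)‖ ≤ N + C ∧
      ∀ n, s ≤ n → ‖latticeVec (position d n) - (N : ℝ) • v‖ ≤ C) :
    v ∈ admissibleRotationSet O := by
  have hpiece : ∀ N : ℕ, ∃ (a b : Space m) (t : ℝ), ExistsAdmissiblePiece O a b t ∧
      (N : ℝ) + 1 ≤ t ∧ t ≤ N + 1 + C + √m ∧ ‖b - a - ((N : ℝ) + 1) • v‖ ≤ D + C := by
    intro N
    -- The shift to `N + 1` makes the target length positive.
    obtain ⟨d, s, hd, hlen, hpos⟩ := h (N + 1)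
    push_cast at hlen hpos
    obtain ⟨n, a, b, t, hsn, hp, h1, h2, h3⟩ :=
      hd.exists_piece hO hcomp hne hD0 hD hdiam s (by positivity) hC hlen
    refine ⟨a, b, t, hp, h1, h2, ?_⟩
    refine (norm_sub_le_norm_sub_add_norm_sub _ (latticeVec (position d n)) _).trans ?_
    exact add_le_add h3 (hpos n hsn)
  choose a b t hp h1 h2 h3 using hpiece
  have htop : Filter.Tendsto t Filter.atTop Filter.atTop :=
    Filter.tendsto_atTop_mono (fun N => (le_add_of_nonneg_right zero_le_one).trans (h1 N))
      tendsto_natCast_atTop_atTop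
  refine ⟨a, b, t, hp, htop, ?_⟩
  rw [tendsto_iff_norm_sub_tendsto_zero]
  set B := D + C + (C + √m) * ‖v‖ with hB
  have hlim : Filter.Tendsto (fun n => (t n)⁻¹ * B) Filter.atTop (nhds 0) := by
    simpa using htop.inv_tendsto_atTop.mul_const B
  refine squeeze_zero (fun _ => norm_nonneg _) (fun N => ?_) hlim
  have htpos : 0 < t N := lt_of_lt_of_le (by positivity) (h1 N)
  have heq : (t N)⁻¹ • (b N - a N) - v =
      (t N)⁻¹ • ((b N - a N - ((N : ℝ) + 1) • v) - (t N - (N + 1)) • v) := by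
    have : v = (t N)⁻¹ • (t N • v) := by rw [smul_smul, inv_mul_cancel₀ htpos.ne', one_smul]
    nth_rewrite 1 [this]
    module
  rw [heq, norm_smul, Real.norm_eq_abs, abs_of_pos (inv_pos.2 htpos)]
  refine mul_le_mul_of_nonneg_left ?_ (inv_pos.2 htpos).le
  refine (norm_sub_le _ _).trans (add_le_add (h3 N) ?_)
  rw [norm_smul, Real.norm_eq_abs, abs_of_nonneg (by linarith [h1 N])]
  exact mul_le_mul_of_nonneg_right (by linarith [h2 N]) (norm_nonneg _)

end Walk

/-! ### Joining, prolonging and repeating lists of steps -/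

section StepList

variable {m : ℕ}

/-- A finite list of steps that never turns by an acute angle. -/
structure IsStepList (l : List (Fin m → ℤ)) : Prop where
  step : ∀ d ∈ l, IsStep d
  turn : l.IsChain fun d e => d ⬝ᵥ e ≤ 0

/-- The total length of a list of steps. -/
noncomputable def cost (l : List (Fin m → ℤ)) : ℝ := (l.map fun d => ‖latticeVec d‖).sum

@[simp] theorem cost_nil : cost ([] : List (Fin m → ℤ)) = 0 := rfl

@[simp] theorem cost_cons (d : Fin m → ℤ) (l : List (Fin m → ℤ)) :
    cost (d :: l) = ‖latticeVec d‖ + cost l := by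
  simp [cost]

@[simp] theorem cost_append (l l' : List (Fin m → ℤ)) : cost (l ++ l') = cost l + cost l' := by
  simp [cost]

theorem IsStepList.nil : IsStepList ([] : List (Fin m → ℤ)) := ⟨by simp, by simp⟩

theorem IsStepList.singleton {d : Fin m → ℤ} (h : IsStep d) : IsStepList [d] :=
  ⟨by simpa using h, by simp⟩

theorem dotProduct_neg_self_nonpos (d : Fin m → ℤ) : d ⬝ᵥ -d ≤ 0 := by
  rw [dotProduct_neg, neg_nonpos]
  exact Finset.sum_nonneg fun i _ => mul_self_nonneg _

/-- Two lists of steps can be joined, with at most one more step between them. -/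
theorem IsStepList.exists_join {l l' : List (Fin m → ℤ)} (hl : IsStepList l)
    (hl' : IsStepList l') :
    ∃ j, IsStepList j ∧ ‖latticeVec j.sum - (latticeVec l.sum + latticeVec l'.sum)‖ ≤ √m ∧
      cost j ≤ cost l + cost l' + √m ∧ (l' ≠ [] → j ≠ []) := by
  by_cases h : ∀ d ∈ l.getLast?, ∀ e ∈ l'.head?, d ⬝ᵥ e ≤ 0
  · refine ⟨l ++ l', ⟨fun d hd => ?_, List.isChain_append.2 ⟨hl.turn, hl'.turn, h⟩⟩, ?_, ?_, ?_⟩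
    · exact (List.mem_append.1 hd).elim (hl.step d) (hl'.step d)
    · simp [latticeVec_add]
    · rw [cost_append]; linarith [Real.sqrt_nonneg m]
    · exact fun h1 h2 => h1 (List.append_eq_nil_iff.1 h2).2
  · push Not at h
    obtain ⟨d, hd, e, he, hde⟩ := h
    have hds : IsStep d := hl.step d (List.mem_of_getLast? hd)
    -- If the junction from `d` to `e` is acute, retracing `d` repairs it: `-d` makes nonpositive
    -- products with both `d` and `e`.
    have hchain : (l ++ -d :: l').IsChain fun d e => d ⬝ᵥ e ≤ 0 := by
      refine List.isChain_append.2 ⟨hl.turn, List.isChain_cons.2 ⟨fun f hf => ?_, hl'.turn⟩,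
        fun f hf g hg => ?_⟩
      · obtain rfl : e = f := Option.mem_unique he hf
        rw [neg_dotProduct]; omega
      · obtain rfl : d = f := Option.mem_unique hd hf
        obtain rfl : -d = g := by simpa using hg
        exact dotProduct_neg_self_nonpos d
    refine ⟨l ++ -d :: l', ⟨fun f hf => ?_, hchain⟩, ?_, ?_, ?_⟩
    · rw [List.mem_append, List.mem_cons] at hf
      rcases hf with hf | rfl | hf
      exacts [hl.step f hf, hds.neg, hl'.step f hf]
    · have : latticeVec (l ++ -d :: l').sum - (latticeVec l.sum + latticeVec l'.sum) =
          latticeVec (-d) := by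
        rw [List.sum_append, List.sum_cons, latticeVec_add, latticeVec_add]; abel
      rw [this]
      exact hds.neg.norm_le
    · rw [cost_append, cost_cons]; linarith [hds.neg.norm_le]
    · simp

/-- The steps of a non-empty list, followed by steps forth and back. -/
def walkOfList (l : List (Fin m → ℤ)) (hl : l ≠ []) (n : ℕ) : Fin m → ℤ :=
  l.getD n (if Even (n - l.length) then -l.getLast hl else l.getLast hl)

theorem walkOfList_of_lt {l : List (Fin m → ℤ)} (hl : l ≠ []) {n : ℕ} (hn : n < l.length) :
    walkOfList l hl n = l[n] :=
  List.getD_eq_getElem _ _ hn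

theorem walkOfList_add {l : List (Fin m → ℤ)} (hl : l ≠ []) (n : ℕ) :
    walkOfList l hl (l.length + n) = if Even n then -l.getLast hl else l.getLast hl := by
  rw [walkOfList, List.getD_eq_default _ _ (Nat.le_add_right _ _), Nat.add_sub_cancel_left]

theorem IsStepList.isWalk {l : List (Fin m → ℤ)} (h : IsStepList l) (hl : l ≠ []) :
    IsWalk (walkOfList l hl) := by
  have hlast : IsStep (l.getLast hl) := h.step _ (List.getLast_mem hl)
  constructor
  · intro n
    rcases lt_or_ge n l.length with hn | hn
    · rw [walkOfList_of_lt hl hn]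
      exact h.step _ (List.getElem_mem hn)
    · obtain ⟨j, rfl⟩ := Nat.exists_eq_add_of_le hn
      rw [walkOfList_add]
      split_ifs
      exacts [hlast.neg, hlast]
  · intro n
    rcases lt_or_ge n l.length with hn | hn
    · rw [walkOfList_of_lt hl hn]
      rcases lt_or_ge (n + 1) l.length with hn' | hn'
      · rw [walkOfList_of_lt hl hn']
        exact List.isChain_iff_getElem.1 h.turn n hn'
      -- Parity is counted from the end of the list, so the first extra step undoes the last one.
      · have hn1 : n + 1 = l.length + 0 := by omega
        have hlast' : l[n] = l.getLast hl := by
          rw [List.getLast_eq_getElem]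
          congr 1
          omega
        rw [hn1, walkOfList_add, if_pos Even.zero, hlast']
        exact dotProduct_neg_self_nonpos _
    · obtain ⟨j, rfl⟩ := Nat.exists_eq_add_of_le hn
      rw [add_assoc, walkOfList_add, walkOfList_add]
      by_cases hj : Even j
      · rw [if_pos hj, if_neg (by rwa [Nat.even_add_one, not_not]), dotProduct_comm]
        exact dotProduct_neg_self_nonpos _
      · rw [if_neg hj, if_pos (by rwa [Nat.even_add_one])]
        exact dotProduct_neg_self_nonpos _

theorem sum_walkOfList {M : Type*} [AddCommMonoid M] (f : (Fin m → ℤ) → M)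
    {l : List (Fin m → ℤ)} (hl : l ≠ []) :
    ∑ i ∈ Finset.range l.length, f (walkOfList l hl i) = (l.map f).sum := by
  rw [Finset.sum_range, ← Fin.sum_univ_fun_getElem]
  exact Finset.sum_congr rfl fun i _ => by rw [walkOfList_of_lt hl i.2]

/-- The prolonged walk oscillates between two points, so it may go on indefinitely with bounded
displacement. -/
theorem position_walkOfList_add {l : List (Fin m → ℤ)} (hl : l ≠ []) (n : ℕ) :
    position (walkOfList l hl) (l.length + n) =
      l.sum + if Even n then 0 else -l.getLast hl := by
  induction n with
  | zero =>
    have := sum_walkOfList id hl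
    rw [List.map_id] at this
    simpa [position] using this
  | succ n ih =>
    rw [← add_assoc, position_succ, ih, walkOfList_add]
    by_cases hn : Even n
    · rw [if_pos hn, if_pos hn, if_neg (by rwa [Nat.even_add_one, not_not]), add_zero]
    · rw [if_neg hn, if_neg hn, if_pos (by rwa [Nat.even_add_one]), neg_add_cancel_right, add_zero]

/-- The steps `f` and `g` in turn, `n` times. -/
def alternating (f g : Fin m → ℤ) : ℕ → List (Fin m → ℤ)
  | 0 => []
  | n + 1 => f :: g :: alternating f g n

theorem isStepList_alternating {f g : Fin m → ℤ} (hf : IsStep f) (hg : IsStep g)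
    (hfg : f ⬝ᵥ g ≤ 0) (n : ℕ) : IsStepList (alternating f g n) := by
  induction n with
  | zero => exact IsStepList.nil
  | succ n ih =>
    refine ⟨fun d hd => ?_, ?_⟩
    · rw [alternating, List.mem_cons, List.mem_cons] at hd
      rcases hd with rfl | rfl | hd
      exacts [hf, hg, ih.step d hd]
    · refine List.isChain_cons_cons.2 ⟨hfg, List.isChain_cons.2 ⟨fun e he => ?_, ih.turn⟩⟩
      cases n with
      | zero => simp [alternating] at he
      | succ n =>
        obtain rfl : f = e := by simpa [alternating] using he
        rwa [dotProduct_comm]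

theorem sum_alternating (f g : Fin m → ℤ) (n : ℕ) :
    latticeVec (alternating f g n).sum = (n : ℝ) • (latticeVec f + latticeVec g) := by
  induction n with
  | zero => simp [alternating]
  | succ n ih =>
    rw [alternating, List.sum_cons, List.sum_cons, latticeVec_add, latticeVec_add, ih]
    push_cast
    module

theorem cost_alternating (f g : Fin m → ℤ) (n : ℕ) :
    cost (alternating f g n) = n * (‖latticeVec f‖ + ‖latticeVec g‖) := by
  induction n with
  | zero => simp [alternating]
  | succ n ih =>
    rw [alternating, cost_cons, cost_cons, ih]
    push_cast
    ring

end StepList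

/-! ### Asymptotic cost of a vector -/

section Achievable

variable {m : ℕ}

/-- Up to bounded errors, the vectors `N v` are reached by lists of steps of length `N T`. -/
def Achievable (v : Space m) (T : ℝ) : Prop :=
  ∃ C : ℝ, ∀ N : ℝ, 0 ≤ N → ∃ l : List (Fin m → ℤ), IsStepList l ∧
    ‖latticeVec l.sum - N • v‖ ≤ C ∧ cost l ≤ N * T + C

theorem Achievable.zero : Achievable (0 : Space m) 0 :=
  ⟨0, fun N _ => ⟨[], IsStepList.nil, by simp, by simp⟩⟩

/-- Each scale `N` needs only one join, whose error `√m` is absorbed in the constant. -/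
theorem Achievable.add {v w : Space m} {S T : ℝ} (hv : Achievable v S) (hw : Achievable w T) :
    Achievable (v + w) (S + T) := by
  obtain ⟨C, hC⟩ := hv
  obtain ⟨C', hC'⟩ := hw
  refine ⟨C + C' + √m, fun N hN => ?_⟩
  obtain ⟨l, hl, h1, h2⟩ := hC N hN
  obtain ⟨l', hl', h1', h2'⟩ := hC' N hN
  obtain ⟨j, hj, h3, h4, -⟩ := hl.exists_join hl'
  refine ⟨j, hj, ?_, by linarith⟩
  have heq : latticeVec j.sum - N • (v + w) =
      (latticeVec l.sum - N • v) + (latticeVec l'.sum - N • w) +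
        (latticeVec j.sum - (latticeVec l.sum + latticeVec l'.sum)) := by
    module
  rw [heq]
  exact (norm_add₃_le).trans (add_le_add (add_le_add h1 h1') h3)

/-- A rescaling of `N`; this is why `Achievable` quantifies over real scales. -/
theorem Achievable.smul {v : Space m} {T : ℝ} (hv : Achievable v T) {c : ℝ} (hc : 0 ≤ c) :
    Achievable (c • v) (c * T) := by
  obtain ⟨C, hC⟩ := hv
  refine ⟨C, fun N hN => ?_⟩
  obtain ⟨l, hl, h1, h2⟩ := hC (N * c) (mul_nonneg hN hc)
  exact ⟨l, hl, by rwa [smul_smul], by rwa [← mul_assoc]⟩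

theorem Achievable.mono {v : Space m} {S T : ℝ} (hv : Achievable v S) (h : S ≤ T) :
    Achievable v T := by
  obtain ⟨C, hC⟩ := hv
  refine ⟨C, fun N hN => ?_⟩
  obtain ⟨l, hl, h1, h2⟩ := hC N hN
  exact ⟨l, hl, h1, h2.trans (by gcongr)⟩

theorem Achievable.sum {ι : Type*} (s : Finset ι) {v : ι → Space m} {T : ι → ℝ}
    (h : ∀ i ∈ s, Achievable (v i) (T i)) : Achievable (∑ i ∈ s, v i) (∑ i ∈ s, T i) := by
  classical
  induction s using Finset.induction_on with
  | empty => simpa using Achievable.zero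
  | insert a s ha ih =>
    rw [Finset.sum_insert ha, Finset.sum_insert ha]
    exact (h a (Finset.mem_insert_self a s)).add
      (ih fun i hi => h i (Finset.mem_insert_of_mem hi))

theorem achievable_add_of_isStep {f g : Fin m → ℤ} (hf : IsStep f) (hg : IsStep g)
    (hfg : f ⬝ᵥ g ≤ 0) :
    Achievable (latticeVec f + latticeVec g) (‖latticeVec f‖ + ‖latticeVec g‖) := by
  refine ⟨‖latticeVec f + latticeVec g‖, fun N hN =>
    ⟨alternating f g ⌊N⌋₊, isStepList_alternating hf hg hfg _, ?_, ?_⟩⟩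
  · rw [sum_alternating, ← sub_smul, norm_smul, Real.norm_eq_abs]
    refine mul_le_of_le_one_left (norm_nonneg _) ?_
    rw [abs_le]
    constructor <;> linarith [Nat.floor_le hN, Nat.lt_floor_add_one N]
  · rw [cost_alternating]
    have : (⌊N⌋₊ : ℝ) * (‖latticeVec f‖ + ‖latticeVec g‖) ≤
        N * (‖latticeVec f‖ + ‖latticeVec g‖) := by
      gcongr
      exact Nat.floor_le hN
    linarith [norm_nonneg (latticeVec f + latticeVec g)]

theorem Achievable.mem_admissibleRotationSet {O : Set (Space m)} (hm : 0 < m) (hO : Convex ℝ O)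
    (hcomp : IsCompact O) (hne : O.Nonempty) {D : ℝ} (hD0 : 0 ≤ D) (hD : D ^ 2 < 1 / 2)
    (hdiam : ∀ x ∈ O, ∀ y ∈ O, dist x y ≤ D) {v : Space m} (hv : Achievable v 1) :
    v ∈ admissibleRotationSet O := by
  obtain ⟨C, hC⟩ := hv
  have hone : IsStep (1 : Fin m → ℤ) :=
    ⟨fun h => by simpa using congrFun h ⟨0, hm⟩, fun i => by simp⟩
  have hC0 : 0 ≤ C := by
    obtain ⟨l, -, h, -⟩ := hC 0 le_rfl
    exact (norm_nonneg _).trans h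
  refine mem_admissibleRotationSet_of_walks hO hcomp hne hD0 hD hdiam
    (C := C + 3 * √m) (by positivity) fun N => ?_
  obtain ⟨l, hl, h1, h2⟩ := hC N N.cast_nonneg
  -- The extra step guarantees a nonempty list, which then has a last step to oscillate along. The
  -- appended step, the join and the oscillation each displace by at most `√m`, whence `3 * √m`.
  obtain ⟨j, hj, h3, h4, h5⟩ := hl.exists_join (IsStepList.singleton hone)
  have hjne : j ≠ [] := h5 (by simp)
  refine ⟨walkOfList j hjne, j.length, hj.isWalk hjne, ?_, fun n hn => ?_⟩
  · rw [sum_walkOfList (fun d => ‖latticeVec d‖) hjne]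
    change cost j ≤ _
    rw [cost_cons, cost_nil] at h4
    linarith [hone.norm_le, Real.sqrt_nonneg m]
  · obtain ⟨i, rfl⟩ := Nat.exists_eq_add_of_le hn
    rw [position_walkOfList_add, latticeVec_add]
    have hlast : ‖latticeVec (if Even i then 0 else -j.getLast hjne)‖ ≤ √m := by
      split_ifs
      · simp
      · exact (hj.step _ (List.getLast_mem hjne)).neg.norm_le
    rw [List.sum_singleton] at h3
    set e := latticeVec (if Even i then 0 else -j.getLast hjne)
    have heq : latticeVec j.sum + e - (N : ℝ) • v = (latticeVec l.sum - (N : ℝ) • v) + e +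
        ((latticeVec j.sum - (latticeVec l.sum + latticeVec 1)) + latticeVec 1) := by
      abel
    rw [heq]
    have h6 := norm_add₃_le (a := latticeVec l.sum - (N : ℝ) • v) (b := e)
      (c := (latticeVec j.sum - (latticeVec l.sum + latticeVec 1)) + latticeVec 1)
    have h7 := norm_add_le (latticeVec j.sum - (latticeVec l.sum + latticeVec 1))
      (latticeVec (1 : Fin m → ℤ))
    linarith [hone.norm_le]

end Achievable

/-! ### Cost of sign vectors -/

section SignedIndicator

variable {m : ℕ} {ε : Fin m → ℤ}

/-- The vector with coordinates `ε i` for `i ∈ S`, and `0` elsewhere. -/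
def signedIndicator (ε : Fin m → ℤ) (S : Finset (Fin m)) (i : Fin m) : ℤ :=
  if i ∈ S then ε i else 0

theorem isStep_signedIndicator (hε : ∀ i, ε i = -1 ∨ ε i = 1) {S : Finset (Fin m)}
    (hS : S.Nonempty) : IsStep (signedIndicator ε S) := by
  constructor
  · obtain ⟨i, hi⟩ := hS
    refine fun h => ?_
    have h1 := congrFun h i
    rw [signedIndicator, if_pos hi, Pi.zero_apply] at h1
    have := hε i
    omega
  · intro i
    unfold signedIndicator
    have := hε i
    split_ifs <;> omega

theorem norm_signedIndicator (hε : ∀ i, ε i = -1 ∨ ε i = 1) (S : Finset (Fin m)) :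
    ‖latticeVec (signedIndicator ε S)‖ = √(S.card : ℝ) := by
  rw [eq_comm, Real.sqrt_eq_iff_eq_sq (Nat.cast_nonneg _) (norm_nonneg _), norm_sq_latticeVec]
  have : signedIndicator ε S ⬝ᵥ signedIndicator ε S = ∑ i, if i ∈ S then (1 : ℤ) else 0 := by
    refine Finset.sum_congr rfl fun i _ => ?_
    unfold signedIndicator
    split_ifs
    · rcases hε i with h | h <;> rw [h] <;> rfl
    · rfl
  rw [this]
  simp

theorem signedIndicator_dotProduct_of_disjoint (ε : Fin m → ℤ) {A B : Finset (Fin m)}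
    (h : Disjoint A B) : signedIndicator ε A ⬝ᵥ signedIndicator ε B = 0 := by
  refine Finset.sum_eq_zero fun i _ => ?_
  unfold signedIndicator
  by_cases hA : i ∈ A
  · rw [if_neg (Finset.disjoint_left.1 h hA), mul_zero]
  · rw [if_neg hA, zero_mul]

theorem signedIndicator_union_of_disjoint (ε : Fin m → ℤ) {A B : Finset (Fin m)}
    (h : Disjoint A B) :
    signedIndicator ε (A ∪ B) = signedIndicator ε A + signedIndicator ε B := by
  ext i
  simp only [signedIndicator, Pi.add_apply, Finset.mem_union]
  by_cases hA : i ∈ A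
  · simp [hA, Finset.disjoint_left.1 h hA]
  · simp [hA]

theorem sqrt_add_sqrt_le (a b : ℝ) (ha : 0 ≤ a) (hb : 0 ≤ b) : √a + √b ≤ √2 * √(a + b) := by
  rw [← Real.sqrt_mul zero_le_two]
  apply Real.le_sqrt_of_sq_le
  nlinarith [Real.sq_sqrt ha, Real.sq_sqrt hb, sq_nonneg (√a - √b)]

/-- A coordinate step cannot be repeated, being at an acute angle with itself. Instead, orthogonal
diagonals in a coordinate plane alternate: (e + f) + (e - f) = 2e costs 2√2. -/
theorem achievable_signedIndicator_singleton (hm : 2 ≤ m) (hε : ∀ i, ε i = -1 ∨ ε i = 1)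
    (i : Fin m) : Achievable (latticeVec (signedIndicator ε {i})) √2 := by
  have : Nontrivial (Fin m) := Fin.nontrivial_iff_two_le.2 hm
  obtain ⟨j, hj⟩ := exists_ne i
  set ε' : Fin m → ℤ := Function.update ε j (-ε j) with hε'_def
  have hε' : ∀ i, ε' i = -1 ∨ ε' i = 1 := by
    intro i
    have h1 := hε i
    have h2 := hε j
    rw [hε'_def, Function.update_apply]
    split_ifs <;> omega
  have hne : ({i, j} : Finset (Fin m)).Nonempty := ⟨i, by simp⟩
  have hdis : Disjoint ({i} : Finset (Fin m)) {j} := by simpa using hj.symm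
  have hunion : ({i, j} : Finset (Fin m)) = {i} ∪ {j} := rfl
  have hi' : signedIndicator ε' {i} = signedIndicator ε {i} := by
    ext l
    simp only [signedIndicator, Finset.mem_singleton]
    split_ifs with h
    · rw [h, hε'_def, Function.update_of_ne hj.symm]
    · rfl
  have hj' : signedIndicator ε' {j} = -signedIndicator ε {j} := by
    ext l
    simp only [signedIndicator, Finset.mem_singleton, Pi.neg_apply]
    split_ifs with h
    · rw [h, hε'_def, Function.update_self]
    · rfl
  have hf : signedIndicator ε {i, j} = signedIndicator ε {i} + signedIndicator ε {j} := by
    rw [hunion, signedIndicator_union_of_disjoint _ hdis]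
  have hg : signedIndicator ε' {i, j} = signedIndicator ε {i} - signedIndicator ε {j} := by
    rw [hunion, signedIndicator_union_of_disjoint _ hdis, hi', hj', sub_eq_add_neg]
  have hsq : ∀ l, signedIndicator ε {l} ⬝ᵥ signedIndicator ε {l} = 1 := by
    intro l
    rw [dotProduct, Finset.sum_eq_single l]
    · simp only [signedIndicator, Finset.mem_singleton, if_true]
      rcases hε l with h | h <;> rw [h] <;> rfl
    · intro b _ hb
      simp [signedIndicator, hb]
    · simp
  have hfg : signedIndicator ε {i, j} ⬝ᵥ signedIndicator ε' {i, j} ≤ 0 := by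
    rw [hf, hg, add_dotProduct, dotProduct_sub, dotProduct_sub, hsq, hsq,
      signedIndicator_dotProduct_of_disjoint ε hdis,
      signedIndicator_dotProduct_of_disjoint ε hdis.symm]
    norm_num
  have h1 := (achievable_add_of_isStep (isStep_signedIndicator hε hne)
    (isStep_signedIndicator hε' hne) hfg).smul (c := 1 / 2) (by norm_num)
  rw [norm_signedIndicator hε, norm_signedIndicator hε', Finset.card_pair hj.symm, hf, hg,
    latticeVec_add, latticeVec_sub] at h1
  convert h1 using 1
  · module
  · push_cast
    ring

/-- Splitting the support into two disjoint nonempty parts gives two orthogonal steps to alternate;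
√a + √b ≤ √2·√(a + b) bounds their cost however the support is split. -/
theorem achievable_signedIndicator (hm : 2 ≤ m) (hε : ∀ i, ε i = -1 ∨ ε i = 1)
    (S : Finset (Fin m)) : Achievable (latticeVec (signedIndicator ε S)) (√2 * √(S.card : ℝ)) := by
  rcases Nat.lt_or_ge S.card 2 with hS | hS
  · obtain h0 | h1 : S.card = 0 ∨ S.card = 1 := by omega
    · obtain rfl := Finset.card_eq_zero.1 h0
      have : latticeVec (signedIndicator ε ∅) = 0 := by
        ext i
        simp [signedIndicator]
      simpa [this] using Achievable.zero
    · obtain ⟨i, rfl⟩ := Finset.card_eq_one.1 h1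
      simpa using achievable_signedIndicator_singleton hm hε i
  · obtain ⟨A, hAS, hA⟩ := Finset.exists_subset_card_eq (s := S) (n := 1) (by omega)
    obtain ⟨B, hB⟩ : ∃ B, B = S \ A := ⟨_, rfl⟩
    have hcard : A.card + B.card = S.card := by
      rw [hB, add_comm, Finset.card_sdiff_add_card_eq_card hAS]
    have hdis : Disjoint A B := hB ▸ Finset.disjoint_sdiff
    have hS' : S = A ∪ B := by rw [hB, Finset.union_sdiff_of_subset hAS]
    have h1 := achievable_add_of_isStep
      (isStep_signedIndicator hε (Finset.card_pos.1 (by omega : 0 < A.card)))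
      (isStep_signedIndicator hε (Finset.card_pos.1 (by omega : 0 < B.card)))
      (signedIndicator_dotProduct_of_disjoint ε hdis).le
    rw [norm_signedIndicator hε, norm_signedIndicator hε, ← latticeVec_add,
      ← signedIndicator_union_of_disjoint ε hdis, ← hS'] at h1
    refine h1.mono ?_
    rw [← hcard, Nat.cast_add]
    exact sqrt_add_sqrt_le _ _ (Nat.cast_nonneg _) (Nat.cast_nonneg _)

end SignedIndicator

/-! ### Layer decomposition and the logarithmic bound -/

section Ball

variable {m : ℕ}

/-- The term `k = 0` equals 1 and the others are at most 1/(4k), so the harmonic bound gives 1 + (1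
+ ln m)/4; this is the origin of the 5. -/
theorem sum_sq_sqrt_sub_sqrt_le {m : ℕ} (hm : 1 ≤ m) :
    ∑ k ∈ Finset.range m, (√((k : ℝ) + 1) - √k) ^ 2 ≤ (Real.log m + 5) / 4 := by
  obtain ⟨n, rfl⟩ : ∃ n, m = n + 1 := ⟨m - 1, by omega⟩
  have hterm : ∀ k : ℕ, (√(((k + 1 : ℕ) : ℝ) + 1) - √((k + 1 : ℕ) : ℝ)) ^ 2 ≤
      1 / 4 * ((k : ℝ) + 1)⁻¹ := by
    intro k
    push_cast
    set a : ℝ := (k : ℝ) + 1 with ha_def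
    have ha : 0 < a := by positivity
    have h1 : √(a + 1) ≤ √a + 1 / (2 * √a) := by
      apply Real.sqrt_le_iff.2
      constructor
      · positivity
      · have hs : 0 < √a := Real.sqrt_pos.2 ha
        have h2 : (√a + 1 / (2 * √a)) ^ 2 = √a ^ 2 + 1 + (1 / (2 * √a)) ^ 2 := by
          field_simp
          ring
        rw [h2, Real.sq_sqrt ha.le]
        nlinarith [sq_nonneg (1 / (2 * √a))]
    have h0 : 0 ≤ √(a + 1) - √a := sub_nonneg.2 (Real.sqrt_le_sqrt (by linarith))
    calc (√(a + 1) - √a) ^ 2 ≤ (1 / (2 * √a)) ^ 2 :=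
          pow_le_pow_left₀ h0 (by linarith) 2
      _ = 1 / 4 * a⁻¹ := by
          rw [div_pow, mul_pow, Real.sq_sqrt ha.le]
          field_simp
          norm_num
  rw [Finset.sum_range_succ']
  have hharm := harmonic_le_one_add_log n
  have hlog : Real.log n ≤ Real.log ((n + 1 : ℕ) : ℝ) := by
    rcases Nat.eq_zero_or_pos n with rfl | hn
    · simp
    · exact Real.log_le_log (by exact_mod_cast hn) (by push_cast; linarith)
  have hsum : ∑ k ∈ Finset.range n, (√(((k + 1 : ℕ) : ℝ) + 1) - √((k + 1 : ℕ) : ℝ)) ^ 2 ≤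
      1 / 4 * (harmonic n : ℝ) := by
    rw [harmonic]
    push_cast
    rw [Finset.mul_sum]
    refine Finset.sum_le_sum fun k _ => ?_
    have := hterm k
    push_cast at this
    exact this
  have hz : (√(((0 : ℕ) : ℝ) + 1) - √((0 : ℕ) : ℝ)) ^ 2 = 1 := by simp
  rw [hz]
  linarith

theorem sum_range_sub_mul (b c : ℕ → ℝ) (hc : c 0 = 0) (n : ℕ) :
    ∑ k ∈ Finset.range n, (b k - b (k + 1)) * c (k + 1) =
      ∑ k ∈ Finset.range n, b k * (c (k + 1) - c k) - b n * c n := by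
  induction n with
  | zero => simp [hc]
  | succ n ih => rw [Finset.sum_range_succ, Finset.sum_range_succ, ih]; ring

/-- A decreasing rearrangement of the absolute values of the coordinates of a vector. -/
theorem exists_antitone_rearrangement (v : Space m) :
    ∃ (σ : Equiv.Perm (Fin m)) (b : ℕ → ℝ), Antitone b ∧ (∀ j : Fin m, b j = |v (σ j)|) ∧
      b m = 0 := by
  have hmono := Tuple.monotone_sort fun i => -|v i|
  set σ := Tuple.sort fun i => -|v i|
  -- Padding by 0 preserves monotonicity and kills the boundary terms in the telescoping and Abel
  -- sums.
  refine ⟨σ, fun k => if h : k < m then |v (σ ⟨k, h⟩)| else 0, fun k l hkl => ?_, ?_, ?_⟩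
  · by_cases hl : l < m
    · have hk : k < m := hkl.trans_lt hl
      have := hmono (show (⟨k, hk⟩ : Fin m) ≤ ⟨l, hl⟩ from hkl)
      simp only [Function.comp_apply, neg_le_neg_iff] at this
      simpa [hl, hk] using this
    · simp only [dif_neg hl]
      split_ifs
      exacts [abs_nonneg _, le_rfl]
  · intro j
    simp
  · simp

/-- With `b` the decreasing absolute values, `v` is the sum over `k` of `b k - b (k + 1)` times the
sign vector on its `k + 1` largest coordinates. Abel summation turns the cost into √2 Σ b k (√(k+1)
- √k), and Cauchy–Schwarz applies. -/
theorem achievable_of_norm (hm : 2 ≤ m) (v : Space m) :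
    Achievable v (‖v‖ * √((Real.log m + 5) / 2)) := by
  obtain ⟨σ, b, hb, hbv, hbm⟩ := exists_antitone_rearrangement v
  set ε : Fin m → ℤ := fun i => if v i < 0 then -1 else 1 with hε_def
  have hε : ∀ i, ε i = -1 ∨ ε i = 1 := by
    intro i
    rw [hε_def]
    dsimp only
    split_ifs <;> simp
  have hεv : ∀ i, |v i| * ε i = v i := by
    intro i
    simp only [hε_def]
    split_ifs with h
    · rw [abs_of_neg h]; push_cast; ring
    · rw [abs_of_nonneg (not_lt.1 h)]; push_cast; ring
  -- The positions of the `k` largest coordinates in absolute value.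
  set S : ℕ → Finset (Fin m) := fun k => Finset.univ.filter fun i => ((σ.symm i : Fin m) : ℕ) < k
  have hScard : ∀ k ≤ m, (S k).card = k := by
    intro k hk
    have : S k = (Finset.univ.filter fun j : Fin m => (j : ℕ) < k).map σ.toEmbedding := by
      ext i
      simp only [S, Finset.mem_filter, Finset.mem_univ, true_and, Finset.mem_map]
      constructor
      · exact fun h => ⟨σ.symm i, h, by simp⟩
      · rintro ⟨j, hj, rfl⟩
        simpa using hj
    rw [this, Finset.card_map, Fin.card_filter_val_lt, min_eq_right hk]
  have hach := Achievable.sum (Finset.range m)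
    (v := fun k => (b k - b (k + 1)) • latticeVec (signedIndicator ε (S (k + 1))))
    (T := fun k => (b k - b (k + 1)) * (√2 * √((k + 1 : ℕ) : ℝ))) fun k hk => by
      have := (achievable_signedIndicator hm hε (S (k + 1))).smul
        (sub_nonneg.2 (hb (Nat.le_succ k)))
      rwa [hScard (k + 1) (Finset.mem_range.1 hk)] at this
  have hsum : ∑ k ∈ Finset.range m,
      (b k - b (k + 1)) • latticeVec (signedIndicator ε (S (k + 1))) = v := by
    ext i
    obtain ⟨j, rfl⟩ := σ.surjective i
    have hterm : ∀ k ∈ Finset.range m,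
        ((b k - b (k + 1)) • latticeVec (signedIndicator ε (S (k + 1)))) (σ j) =
        if (j : ℕ) ≤ k then (b k - b (k + 1)) * ε (σ j) else 0 := by
      intro k _
      simp [S, signedIndicator]
    rw [WithLp.ofLp_sum, Finset.sum_apply, Finset.sum_congr rfl hterm, ← Finset.sum_filter]
    have hfilter : (Finset.range m).filter (fun k => (j : ℕ) ≤ k) = Finset.Ico (j : ℕ) m := by
      ext k
      simp only [Finset.mem_filter, Finset.mem_range, Finset.mem_Ico]
      omega
    have htel : ∑ k ∈ Finset.Ico (j : ℕ) m, (b k - b (k + 1)) = b j - b m := by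
      have := Finset.sum_Ico_sub b j.2.le
      rw [← neg_sub, ← this, ← Finset.sum_neg_distrib]
      simp
    rw [hfilter, ← Finset.sum_mul, htel, hbm, sub_zero, hbv, hεv]
  rw [hsum] at hach
  refine hach.mono ?_
  have habel := sum_range_sub_mul b (fun k => √2 * √(k : ℝ)) (by simp) m
  rw [hbm, zero_mul, sub_zero] at habel
  rw [habel]
  have hnorm : ∑ k ∈ Finset.range m, b k ^ 2 = ‖v‖ ^ 2 := by
    rw [EuclideanSpace.real_norm_sq_eq, Finset.sum_range, ← Equiv.sum_comp σ fun i => v i ^ 2]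
    exact Finset.sum_congr rfl fun j _ => by rw [hbv, sq_abs]
  have hcs := Finset.sum_mul_sq_le_sq_mul_sq (Finset.range m) b
    fun k => √2 * √((k + 1 : ℕ) : ℝ) - √2 * √(k : ℝ)
  have hsq : ∑ k ∈ Finset.range m, (√2 * √((k + 1 : ℕ) : ℝ) - √2 * √(k : ℝ)) ^ 2 ≤
      (Real.log m + 5) / 2 := by
    have h1 := sum_sq_sqrt_sub_sqrt_le (m := m) (by omega)
    have h2 : ∑ k ∈ Finset.range m, (√2 * √((k + 1 : ℕ) : ℝ) - √2 * √(k : ℝ)) ^ 2 =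
        2 * ∑ k ∈ Finset.range m, (√((k : ℝ) + 1) - √k) ^ 2 := by
      rw [Finset.mul_sum]
      refine Finset.sum_congr rfl fun k _ => ?_
      rw [← mul_sub, mul_pow, Real.sq_sqrt zero_le_two]
      push_cast
      rfl
    rw [h2]
    linarith
  rw [← Real.sqrt_sq (norm_nonneg v), ← Real.sqrt_mul (sq_nonneg _)]
  apply Real.le_sqrt_of_sq_le
  refine hcs.trans ?_
  rw [hnorm]
  exact mul_le_mul_of_nonneg_left hsq (sq_nonneg _)

end Ball

end TorusBilliard

theorem mainTheorem8 (m : ℕ) (hm : 2 ≤ m) (O : Set (TorusBilliard.Space m))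
    (hO : TorusBilliard.IsObstacle O) (hsmall : TorusBilliard.IsSmall O) :
    Metric.closedBall (0 : TorusBilliard.Space m) (√(2 / (Real.log m + 5))) ⊆
      TorusBilliard.admissibleRotationSet O := by
  intro v hv
  rw [mem_closedBall_zero_iff] at hv
  obtain ⟨c, r, hr, hOr⟩ := hsmall
  have hne : O.Nonempty := hO.interior_nonempty.mono interior_subset
  have hr0 : 0 ≤ r := by
    obtain ⟨x, hx⟩ := hne
    exact dist_nonneg.trans (Metric.mem_closedBall.1 (hOr hx))
  -- The radius bound √2/4 says exactly that the diameter bound `2 * r` is below √2/2, the clearance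
  -- of the walks.
  have hD : (2 * r) ^ 2 < 1 / 2 := by
    have h2 : √2 ^ 2 = 2 := Real.sq_sqrt zero_le_two
    nlinarith
  have hdiam : ∀ x ∈ O, ∀ y ∈ O, dist x y ≤ 2 * r := by
    intro x hx y hy
    have h1 := dist_triangle_right x y c
    have h2 := Metric.mem_closedBall.1 (hOr hx)
    have h3 := Metric.mem_closedBall.1 (hOr hy)
    linarith
  have hlog : 0 < Real.log m + 5 := by
    have : 0 ≤ Real.log m := Real.log_natCast_nonneg m
    linarith
  refine TorusBilliard.Achievable.mem_admissibleRotationSet (by omega) hO.strictConvex.convex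
    hO.isCompact hne (by positivity) hD hdiam
    ((TorusBilliard.achievable_of_norm hm v).mono ?_)
  calc ‖v‖ * √((Real.log m + 5) / 2)
      ≤ √(2 / (Real.log m + 5)) * √((Real.log m + 5) / 2) := by gcongr
    _ = 1 := by
      rw [← Real.sqrt_mul (by positivity), div_mul_div_cancel₀ hlog.ne', div_self two_ne_zero,
        Real.sqrt_one]
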